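/- Let $m,q\ge 0$ be integers, $X=\{x_0,x_1,\dots,x_m\}$ noncommuting letters and $\tilde X=\{\tilde x_1,\dots,\tilde x_q\}$ commuting letters. A series $c=(c_1,\dots,c_\ell)\in\mathbb R^\ell\langle\langle X\rangle\rangle$ assigns to each word $\eta\in X^*$ a coefficient $(c,\eta)\in\mathbb R^\ell$; it is proper if $(c,\emptyset)=0$, and $\mathbb R^q_p\langle\langle X\rangle\rangle$ denotes the set of proper series in $\mathbb R^q\langle\langle X\rangle\rangle$. A series $d\in\mathbb R^m[[\tilde X]]$ in the commuting letters is purely improper if all of its components $d_1,\dots,d_m$ have nonzero constant term. All products of vector-valued series are taken componentwise, and $\mathbf 1$ is the vector whose components all equal the constant series $1$. The purely improper series in $\mathbb R^m[[\tilde X]]$ form an abelian group under the Cauchy product, with identity $\mathbf 1$ and inverse $d\mapsto d^{-1}$. Let $\mathbin{\sqcup\!\sqcup}$ be the shuffle product, extended from words to series bilinearly and coefficientwise. For $d\in\mathbb R^m\langle\langle X\rangle\rangle$ define $\bar\phi_d$ on words by letting $\bar\phi_d(\emptyset)$ be the identity map and $\bar\phi_d(x_i\eta)=\bar\phi_d(x_i)\circ\bar\phi_d(\eta)$,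 where $\bar\phi_d(x_0)(e)=x_0e$ and $\bar\phi_d(x_i)(e)=x_i(d_i \mathbin{\sqcup\!\sqcup} e)$ for $1\le i\le m$ and $e\in\mathbb R\langle\langle X\rangle\rangle$. The multiplicative mixed composition product of $c\in\mathbb R^\ell\langle\langle X\rangle\rangle$ with $d$ is $$c\curvearrowleft\delta_d=\sum_{\eta\in X^*}(c,\eta)\,\bar\phi_d(\eta)(1).$$ On the symbols $\delta_d$, $d\in\mathbb R^m\langle\langle X\rangle\rangle$, put $\delta_c\circ\delta_d=\delta_{\,d \mathbin{\sqcup\!\sqcup} (c\curvearrowleft\delta_d)}$; the symbol $\delta_{\mathbf 1}$ is the identity for $\circ$. When $\delta_d$ has a unique two-sided inverse for $\circ$, this inverse is written $\delta_{d^{\circ-1}}$. For $d\in\mathbb R^m[[\tilde X]]$ and $c\in\mathbb R^q_p\langle\langle X\rangle\rangle$ the Wiener–Fliess composition product is $$d\mathbin{\hat\circ}c=\sum_{n\in\mathbb N^q}(d,\tilde x^{\,n})\;c_1^{\sqcup\!\sqcup\, n_1} \mathbin{\sqcup\!\sqcup}\cdots\mathbin{\sqcup\!\sqcup} c_q^{\sqcup\!\sqcup\,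 n_q}\in\mathbb R^m\langle\langle X\rangle\rangle .$$ **Theorem.** For every $c\in\mathbb R^q_p\langle\langle X\rangle\rangle$ and every purely improper $d\in\mathbb R^m[[\tilde X]]$, the element $\delta_{d^{-1}\hat\circ c}$ has a unique two-sided inverse for $\circ$, so that the multiplicative static feedback product $$c\,\bar@\,d:=c\curvearrowleft\delta_{(d^{-1}\hat\circ c)^{\circ-1}}$$ is defined. It is a right action of the abelian group of purely improper series in $\mathbb R^m[[\tilde X]]$ under the Cauchy product on the set $\mathbb R^q_p\langle\langle X\rangle\rangle$: for all $c\in\mathbb R^q_p\langle\langle X\rangle\rangle$ and all purely improper $d_1,d_2\in\mathbb R^m[[\tilde X]]$, the series $c\,\bar@\,d_1$ is again proper, $c\,\bar@\,\mathbf 1=c$, and $(c\,\bar@\,d_1)\,\bar@\,d_2=c\,\bar@\,(d_1\cdot d_2)$. -/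

import Mathlib

namespace ChenFliess

/-- Words over the alphabet `X = {x₀, x₁, …, x_m}`; the letter `x_j` is `j : Fin (m + 1)`. -/
abbrev Word (m : ℕ) : Type := List (Fin (m + 1))

/-- Scalar formal power series `ℝ⟨⟨X⟩⟩`: the function `η ↦ (c, η)` of coefficients. -/
abbrev Series (m : ℕ) : Type := Word m → ℝ

/-- Vector-valued series `ℝ^ℓ⟨⟨X⟩⟩`, given by their components `c_i`. -/
abbrev VecSeries (m ℓ : ℕ) : Type := Fin ℓ → Series m

/-- The monomial `1 ∅`. -/
def unitSeries (m : ℕ) : Series m := fun η => if η = [] then 1 else 0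

/-- The vector `𝟙 = [1 1 ⋯ 1]ᵗ` of constant series. -/
def unitVec (m ℓ : ℕ) : VecSeries m ℓ := fun _ => unitSeries m

/-- A series is proper when its constant term `(c, ∅) ∈ ℝ^ℓ` vanishes. -/
def IsProper {m ℓ : ℕ} (c : VecSeries m ℓ) : Prop := ∀ i, c i [] = 0

/-- The set of proper series in `ℝ^ℓ⟨⟨X⟩⟩`. -/
abbrev ProperSeries (m ℓ : ℕ) : Type := {c : VecSeries m ℓ // IsProper c}

/-- Left catenation `e ↦ x e` by a letter. -/
def letterMul {m : ℕ} (x : Fin (m + 1)) (e : Series m) : Series m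
  | [] => 0
  | y :: ξ => if y = x then e ξ else 0

/-- The shuffle product of two words, as the multiset of the words that occur in it:
`(x ζ) ⧢ (y ν) = x (ζ ⧢ (y ν)) + y ((x ζ) ⧢ ν)`. -/
def shuffleWord {α : Type} : List α → List α → Multiset (List α)
  | [], ν => {ν}
  | x :: ζ, [] => {x :: ζ}
  | x :: ζ, y :: ν =>
      (shuffleWord ζ (y :: ν)).map (x :: ·) + (shuffleWord (x :: ζ) ν).map (y :: ·)
  termination_by ζ ν => ζ.length + ν.length

theorem length_of_mem_shuffleWord {α : Type} (ζ ν η : List α) (h : η ∈ shuffleWord ζ ν) :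
    η.length = ζ.length + ν.length := by
  induction ζ, ν using shuffleWord.induct generalizing η with
  | case1 ν => simp [shuffleWord] at h; simp [h]
  | case2 x ζ => simp [shuffleWord] at h; simp [h]
  | case3 x ζ y ν ih1 ih2 =>
    rw [shuffleWord, Multiset.mem_add, Multiset.mem_map, Multiset.mem_map] at h
    rcases h with ⟨a, ha, rfl⟩ | ⟨a, ha, rfl⟩
    · simp [ih1 a ha]; omega
    · simp [ih2 a ha]; omega

/-- The shuffle product of two series, `∑_{ζ, ν} (c, ζ) (d, ν) ζ ⧢ ν`. -/
noncomputable def shuffle {m : ℕ} (c d : Series m) : Series m := fun η =>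
  ∑ᶠ p : Word m × Word m, ((shuffleWord p.1 p.2).count η : ℝ) * (c p.1 * d p.2)

/-- The sum in the definition of `shuffle` is finite. -/
theorem shuffle_support_finite {m : ℕ} (c d : Series m) (η : Word m) :
    (Function.support fun p : Word m × Word m =>
      ((shuffleWord p.1 p.2).count η : ℝ) * (c p.1 * d p.2)).Finite := by
  refine ((List.finite_length_le (Fin (m + 1)) η.length).prod
    (List.finite_length_le (Fin (m + 1)) η.length)).subset ?_
  rintro ⟨ζ, ν⟩ hp
  have h0 : (shuffleWord ζ ν).count η ≠ 0 := by
    intro h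
    simp [h] at hp
  have h := length_of_mem_shuffleWord ζ ν η (Multiset.count_ne_zero.mp h0)
  constructor <;> simp only [Set.mem_ofPred_eq] <;> omega

/-- The order of a shuffle product is at least the sum of lower bounds for the orders. -/
theorem shuffle_eq_zero {m : ℕ} (c d : Series m) (j k : ℕ)
    (hc : ∀ ξ : Word m, ξ.length < j → c ξ = 0) (hd : ∀ ξ : Word m, ξ.length < k → d ξ = 0)
    (ξ : Word m) (h : ξ.length < j + k) : shuffle c d ξ = 0 := by
  rw [shuffle, finsum_eq_zero_of_forall_eq_zero]
  rintro ⟨ζ, ν⟩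
  by_cases h0 : (shuffleWord ζ ν).count ξ = 0
  · simp [h0]
  · have hl := length_of_mem_shuffleWord ζ ν ξ (Multiset.count_ne_zero.mp h0)
    rcases lt_or_ge ζ.length j with h1 | h1
    · simp [hc ζ h1]
    · simp [hd ν (by omega)]

/-- The endomorphism attached to a letter by the multiplicative mixed composition product with
`δ_d = δ ⧢ d`: it sends `e` to `x₀ e` for the letter `x₀`, and to `x_i (d_i ⧢ e)` for the letter
`x_i`, `i ≥ 1`. -/
noncomputable def mixLetter {m : ℕ} (d : VecSeries m m) (x : Fin (m + 1)) (e : Series m) :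
    Series m :=
  letterMul x (Fin.cases e (fun i => shuffle (d i) e) x)

/-- The mixed composition of a word with `δ_d`: the composite of the endomorphisms of its letters,
evaluated at `1`. -/
noncomputable def mixWord {m : ℕ} (d : VecSeries m m) (η : Word m) : Series m :=
  η.foldr (mixLetter d) (unitSeries m)

/-- The multiplicative mixed composition product of `c` and `δ_d`, componentwise in `c`:
`∑_η (c, η) (η mixed with δ_d)`. -/
noncomputable def mixComp {m ℓ : ℕ} (c : VecSeries m ℓ) (d : VecSeries m m) : VecSeries m ℓ :=
  fun i ξ => ∑ᶠ η : Word m, c i η * mixWord d η ξ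

theorem mixWord_eq_zero {m : ℕ} (d : VecSeries m m) (η ξ : Word m) (h : ξ.length < η.length) :
    mixWord d η ξ = 0 := by
  induction η generalizing ξ with
  | nil => simp at h
  | cons x η ih =>
    change letterMul x _ ξ = 0
    cases ξ with
    | nil => rfl
    | cons y ξ =>
      have hlt : ξ.length < η.length := by simpa using h
      rw [letterMul]
      split_ifs with hy
      · refine Fin.cases ?_ (fun i => ?_) x
        · exact ih ξ hlt
        · exact shuffle_eq_zero _ _ 0 η.length (by simp) ih ξ (by omega)
      · rfl

/-- The sum over words that defines the mixed composition product is locally finite. -/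
theorem mixComp_support_finite {m : ℕ} (c : Series m) (d : VecSeries m m) (ξ : Word m) :
    (Function.support fun η : Word m => c η * mixWord d η ξ).Finite := by
  refine (List.finite_length_le (Fin (m + 1)) ξ.length).subset fun η hη => ?_
  by_contra hlt
  exact hη (by simp [mixWord_eq_zero d η ξ (by simpa using hlt)])

/-- The multiplicative composition product `δ_c ∘ δ_d = δ_{d ⧢ (c mixed with δ_d)}`, written on the
series `c`, `d` that represent `δ_c = δ ⧢ c` and `δ_d = δ ⧢ d`. Its identity is `δ_𝟙`. -/
noncomputable def mulComp {m : ℕ} (c d : VecSeries m m) : VecSeries m m :=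
  fun i => shuffle (d i) (mixComp c d i)

/-- `δ_e` is a two-sided inverse of `δ_d` for the multiplicative composition product. -/
def IsCompInverse {m : ℕ} (d e : VecSeries m m) : Prop :=
  mulComp d e = unitVec m m ∧ mulComp e d = unitVec m m

open scoped Classical in
/-- The series `d^{∘-1}` with `δ_{d^{∘-1}} = (δ_d)^{∘-1}` (and `𝟙` if `δ_d` is not invertible). -/
noncomputable def compInv {m : ℕ} (d : VecSeries m m) : VecSeries m m :=
  if h : ∃ e, IsCompInverse d e then h.choose else unitVec m m

/-- The shuffle power of `c` along a word in the letters `x̃₁, …, x̃_q`: the power along `∅` is `1`,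
and the power along `x̃_i η` is `c_i` shuffled with the power along `η`. -/
noncomputable def shufflePow {m q : ℕ} (c : VecSeries m q) : List (Fin q) → Series m
  | [] => unitSeries m
  | i :: η => shuffle (c i) (shufflePow c η)

/-- The word `x̃₁^{n₁} ⋯ x̃_q^{n_q}` that represents a monomial in the commuting letters. -/
def monomialWord {q : ℕ} (n : Fin q →₀ ℕ) : List (Fin q) :=
  (List.finRange q).flatMap fun j => List.replicate (n j) j

/-- The Wiener–Fliess composition product of `d ∈ ℝ^k[[X̃]]`, `X̃ = {x̃₁, …, x̃_q}`, with a proper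
series `c ∈ ℝ^q⟨⟨X⟩⟩`: the sum over the commutative monomials `η` of `(d, η)` times the shuffle power
of `c` along `η`. -/
noncomputable def wienerFliess {m q k : ℕ} (d : Fin k → MvPowerSeries (Fin q) ℝ)
    (c : VecSeries m q) : VecSeries m k :=
  fun i ξ => ∑ᶠ n : Fin q →₀ ℕ, MvPowerSeries.coeff n (d i) * shufflePow c (monomialWord n) ξ

theorem shufflePow_eq_zero {m q : ℕ} (c : VecSeries m q) (hc : IsProper c) (w : List (Fin q))
    (ξ : Word m) (h : ξ.length < w.length) : shufflePow c w ξ = 0 := by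
  induction w generalizing ξ with
  | nil => simp at h
  | cons i w ih =>
    refine shuffle_eq_zero _ _ 1 w.length (fun ζ hζ => ?_) ih ξ (by simp at h; omega)
    rw [List.length_eq_zero_iff.mp (by omega : ζ.length = 0)]
    exact hc i

theorem count_monomialWord {q : ℕ} (n : Fin q →₀ ℕ) (j : Fin q) :
    (monomialWord n).count j = n j := by
  simp only [monomialWord, List.count_flatMap, Function.comp_def, List.count_replicate]
  rw [← List.ofFn_eq_map, List.sum_ofFn]
  simp

/-- For a proper series `c`, the sum over monomials that defines the Wiener–Fliess composition
product is locally finite. -/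
theorem wienerFliess_support_finite {m q : ℕ} (d : MvPowerSeries (Fin q) ℝ) (c : VecSeries m q)
    (hc : IsProper c) (ξ : Word m) :
    (Function.support fun n : Fin q →₀ ℕ =>
      MvPowerSeries.coeff n d * shufflePow c (monomialWord n) ξ).Finite := by
  have hinj : Function.Injective (monomialWord (q := q)) := fun a b hab =>
    Finsupp.ext fun j => by rw [← count_monomialWord a, hab, count_monomialWord]
  refine ((List.finite_length_le (Fin q) ξ.length).preimage hinj.injOn).subset fun n hn => ?_
  by_contra hlt
  exact hn (by simp [shufflePow_eq_zero c hc (monomialWord n) ξ (by simpa using hlt)])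

/-- The purely improper commutative series in `ℝ^m[[X̃]]`, `X̃ = {x̃₁, …, x̃_q}`: every component has
a nonzero constant term. -/
def PurelyImproper (m q : ℕ) : Type :=
  {d : Fin m → MvPowerSeries (Fin q) ℝ // ∀ i, MvPowerSeries.constantCoeff (d i) ≠ 0}

/-- The abelian group structure on purely improper commutative series given by the
(componentwise) Cauchy product, with the constant series `𝟙` as identity. -/
noncomputable instance (m q : ℕ) : CommGroup (PurelyImproper m q) where
  mul a b := ⟨a.1 * b.1, fun i => by
    simpa using mul_ne_zero (a.2 i) (b.2 i)⟩
  one := ⟨1, fun i => by simp⟩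
  inv a := ⟨fun i => (a.1 i)⁻¹, fun i => by
    simpa using a.2 i⟩
  mul_assoc a b c := Subtype.ext (mul_assoc a.1 b.1 c.1)
  one_mul a := Subtype.ext (one_mul a.1)
  mul_one a := Subtype.ext (mul_one a.1)
  mul_comm a b := Subtype.ext (mul_comm a.1 b.1)
  inv_mul_cancel a := Subtype.ext (funext fun i => MvPowerSeries.inv_mul_cancel (a.1 i) (a.2 i))

/-- The multiplicative static feedback product: the mixed composition product of `c` and
`δ_w`, where `w = (d⁻¹ composed with c)^{∘-1}` and `d⁻¹` is the Cauchy inverse. -/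
noncomputable def staticFeedback {m q : ℕ} (c : VecSeries m q) (d : PurelyImproper m q) :
    VecSeries m q :=
  mixComp c (compInv (wienerFliess (d⁻¹).1 c))

end ChenFliess

/-! Under the shuffle product, series form a commutative algebra on which the left derivatives `D x`
are derivations. A series is determined by its constant term and its left derivatives, so identities
are proved by induction on the word length up to which both sides agree (`agreeBelow_succ`).

The rule `D_mixFun` makes mixed composition with `δ_e` an algebra endomorphism `mix e`, and
`mix_mix` shows that these endomorphisms compose through `comp`. A contraction argument then inverts
every tuple with nonzero constant terms (`exists_comp_eq_one`). Substituting a proper tuple into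
commutative series is multiplicative (`subst_mul`) and commutes with `mix e` (`mix_subst`). Hence
the inverse `e` of `d⁻¹ ∘̂ c` is exactly the solution of the feedback equation `e = d ∘̂ (c ↶ δ_e)`
(`eq_compInv_iff`).

For the action law, let `e₁`, `e₂` be the feedback series of two successive loops and `c₂` the final
output. Then `c₂ = c ↶ δ_{e₁ ∘ e₂}`, and `e₁ ∘ e₂` is the shuffle of `d₂ ∘̂ c₂` with `d₁ ∘̂ c₂`,
that is `(d₁ d₂) ∘̂ c₂`. So `e₁ ∘ e₂` solves the feedback equation for `d₁ d₂`. -/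

namespace ChenFliess

variable {m : ℕ}

/-! ### Shuffle product: Leibniz rule and ring axioms -/

/-- Left derivative of a series: `(shift x c, η) = (c, x η)`. -/
def shift (x : Fin (m + 1)) (c : Series m) : Series m := fun η => c (x :: η)

@[simp]
theorem shift_apply (x : Fin (m + 1)) (c : Series m) (η : Word m) : shift x c η = c (x :: η) := rfl

theorem finsum_eq_finsum_of_injective {α β M : Type*} [AddCommMonoid M] {g : β → α} {f : α → M}
    (hg : Function.Injective g) (h : Function.support f ⊆ Set.range g) :
    ∑ᶠ i, f i = ∑ᶠ j, f (g j) := by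
  rw [← finsum_mem_range hg, finsum_mem_def, Set.indicator_eq_self.mpr h]

theorem count_map_cons {α : Type} [DecidableEq α] (s : Multiset (List α)) (x y : α)
    (η : List α) : (s.map (y :: ·)).count (x :: η) = if y = x then s.count η else 0 := by
  split_ifs with h
  · subst h
    exact Multiset.count_map_eq_count' _ _ (List.cons_injective) _
  · rw [Multiset.count_eq_zero]
    simp [h]

/-- The first letter of a word occurring in a shuffle comes from one of the two factors. -/
theorem count_shuffleWord_cons {α : Type} [DecidableEq α] (ζ ν η : List α) (x : α) :
    (shuffleWord ζ ν).count (x :: η) =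
      (match ζ with
        | [] => 0
        | y :: ζ' => if y = x then (shuffleWord ζ' ν).count η else 0) +
      (match ν with
        | [] => 0
        | y :: ν' => if y = x then (shuffleWord ζ ν').count η else 0) := by
  have hs : ∀ ν : List α, shuffleWord [] ν = {ν} := fun ν => by simp [shuffleWord]
  have hs' : ∀ ν : List α, shuffleWord ν [] = {ν} := fun ν => by cases ν <;> simp [shuffleWord]
  cases ζ with
  | nil =>
    cases ν with
    | nil => simp [hs]
    | cons y ν =>
      simp only [hs, Multiset.count_singleton, List.cons.injEq, zero_add]
      grind
  | cons z ζ =>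
    cases ν with
    | nil =>
      simp only [hs', Multiset.count_singleton, List.cons.injEq, add_zero]
      grind
    | cons y ν =>
      rw [shuffleWord, Multiset.count_add, count_map_cons, count_map_cons]

theorem shuffle_nil (c d : Series m) : shuffle c d [] = c [] * d [] := by
  rw [shuffle, finsum_eq_single _ ([], [])]
  · simp [shuffleWord]
  · rintro ⟨ζ, ν⟩ h
    have h0 : (shuffleWord ζ ν).count [] = 0 := by
      rw [Multiset.count_eq_zero]
      intro hm
      have := length_of_mem_shuffleWord ζ ν [] hm
      simp only [List.length_nil] at this
      exact h (Prod.ext (List.length_eq_zero_iff.mp (by dsimp only; omega))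
        (List.length_eq_zero_iff.mp (by dsimp only; omega)))
    simp [h0]

/-- The left derivatives are derivations of the shuffle product. -/
theorem shuffle_cons (c d : Series m) (x : Fin (m + 1)) (η : Word m) :
    shuffle c d (x :: η) = shuffle (shift x c) d η + shuffle c (shift x d) η := by
  -- `f` collects the terms whose leading `x` comes from the left factor, `g` those where it comes
  -- from the right one; each is reindexed by stripping that letter.
  let f : Word m × Word m → ℝ := fun p =>
    ((match p.1 with
        | [] => 0
        | y :: ζ' => if y = x then (shuffleWord ζ' p.2).count η else 0 : ℕ) : ℝ) * (c p.1 * d p.2)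
  let g : Word m × Word m → ℝ := fun p =>
    ((match p.2 with
        | [] => 0
        | y :: ν' => if y = x then (shuffleWord p.1 ν').count η else 0 : ℕ) : ℝ) * (c p.1 * d p.2)
  have hf : Function.support f ⊆ Set.range (Prod.map (x :: ·) id) := by
    rintro ⟨ζ, ν⟩ h
    cases ζ with
    | nil => simp [f] at h
    | cons y ζ =>
      by_cases hy : y = x
      · exact ⟨(ζ, ν), by simp [hy]⟩
      · simp [f, hy] at h
  have hg : Function.support g ⊆ Set.range (Prod.map id (x :: ·)) := by
    rintro ⟨ζ, ν⟩ h
    cases ν with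
    | nil => simp [g] at h
    | cons y ν =>
      by_cases hy : y = x
      · exact ⟨(ζ, ν), by simp [hy]⟩
      · simp [g, hy] at h
  have hfi : Function.Injective (Prod.map (x :: ·) id : Word m × Word m → Word m × Word m) :=
    List.cons_injective.prodMap Function.injective_id
  have hgi : Function.Injective (Prod.map id (x :: ·) : Word m × Word m → Word m × Word m) :=
    Function.injective_id.prodMap List.cons_injective
  have hfc : f ∘ Prod.map (x :: ·) id = fun p : Word m × Word m =>
      ((shuffleWord p.1 p.2).count η : ℝ) * (shift x c p.1 * d p.2) := by
    funext p; simp [f]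
  have hgc : g ∘ Prod.map id (x :: ·) = fun p : Word m × Word m =>
      ((shuffleWord p.1 p.2).count η : ℝ) * (c p.1 * shift x d p.2) := by
    funext p; simp [g]
  have hff : (Function.support f).Finite := by
    refine ((shuffle_support_finite (shift x c) d η).image (Prod.map (x :: ·) id)).subset ?_
    intro p hp
    obtain ⟨p, rfl⟩ := hf hp
    exact ⟨p, by rw [← hfc]; exact hp, rfl⟩
  have hgf : (Function.support g).Finite := by
    refine ((shuffle_support_finite c (shift x d) η).image (Prod.map id (x :: ·))).subset ?_
    intro p hp
    obtain ⟨p, rfl⟩ := hg hp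
    exact ⟨p, by rw [← hgc]; exact hp, rfl⟩
  have hsplit : shuffle c d (x :: η) = ∑ᶠ p, (f p + g p) := by
    refine finsum_congr fun p => ?_
    rw [count_shuffleWord_cons, Nat.cast_add, add_mul]
    rcases p with ⟨_ | _, _ | _⟩ <;> rfl
  rw [hsplit, finsum_add_distrib hff hgf, finsum_eq_finsum_of_injective hfi hf,
    finsum_eq_finsum_of_injective hgi hg]
  exact congrArg₂ (· + ·) (congrArg finsum hfc) (congrArg finsum hgc)

theorem shift_shuffle (c d : Series m) (x : Fin (m + 1)) :
    shift x (shuffle c d) = shuffle (shift x c) d + shuffle c (shift x d) :=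
  funext fun η => shuffle_cons c d x η

theorem shuffle_comm (c d : Series m) : shuffle c d = shuffle d c := by
  funext ξ
  induction ξ generalizing c d with
  | nil => rw [shuffle_nil, shuffle_nil, mul_comm]
  | cons x ξ ih => rw [shuffle_cons, shuffle_cons, ih, ih c, add_comm]

theorem shuffle_add (a b c : Series m) : shuffle a (b + c) = shuffle a b + shuffle a c := by
  funext ξ
  induction ξ generalizing a b c with
  | nil => simp only [shuffle_nil, Pi.add_apply, mul_add]
  | cons x ξ ih =>
    have h : shift x (b + c) = shift x b + shift x c := rfl
    simp only [shuffle_cons, Pi.add_apply, h, ih]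
    ring

theorem shuffle_smul (r : ℝ) (a b : Series m) : shuffle a (r • b) = r • shuffle a b := by
  funext ξ
  induction ξ generalizing a b with
  | nil => simp only [shuffle_nil, Pi.smul_apply, smul_eq_mul]; ring
  | cons x ξ ih =>
    have h : shift x (r • b) = r • shift x b := rfl
    simp only [shuffle_cons, Pi.smul_apply, h, ih, smul_add]

theorem add_shuffle (a b c : Series m) : shuffle (a + b) c = shuffle a c + shuffle b c := by
  rw [shuffle_comm, shuffle_add, shuffle_comm c, shuffle_comm c]

theorem smul_shuffle (r : ℝ) (a b : Series m) : shuffle (r • a) b = r • shuffle a b := by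
  rw [shuffle_comm, shuffle_smul, shuffle_comm]

theorem shift_shuffle' (x : Fin (m + 1)) (c d : Series m) :
    shift x (shuffle c d) = shuffle c (shift x d) + shuffle d (shift x c) := by
  rw [shift_shuffle, add_comm, shuffle_comm d]

theorem shuffle_assoc (a b c : Series m) : shuffle (shuffle a b) c = shuffle a (shuffle b c) := by
  funext ξ
  induction ξ generalizing a b c with
  | nil => simp only [shuffle_nil, mul_assoc]
  | cons x ξ ih =>
    rw [shuffle_cons, shuffle_cons, shift_shuffle, shift_shuffle, add_shuffle, shuffle_add]
    simp only [Pi.add_apply, ih]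
    ring

theorem shift_unitSeries (x : Fin (m + 1)) : shift x (unitSeries m) = 0 := by
  funext η; simp [unitSeries]

theorem shuffle_zero (a : Series m) : shuffle a 0 = 0 := by
  simpa using shuffle_smul 0 a 0

theorem shuffle_unit (a : Series m) : shuffle a (unitSeries m) = a := by
  funext ξ
  induction ξ generalizing a with
  | nil => simp [shuffle_nil, unitSeries]
  | cons x ξ ih => simp [shuffle_cons, shift_unitSeries, shuffle_zero, ih]

/-! ### The shuffle algebra and agreement up to a given word length -/

/-- Series in noncommuting letters, as a commutative algebra under the shuffle product. -/
def ShuffleAlgebra (m : ℕ) : Type := Series m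

namespace ShuffleAlgebra

noncomputable instance : AddCommGroup (ShuffleAlgebra m) :=
  inferInstanceAs (AddCommGroup (Word m → ℝ))

noncomputable instance : Module ℝ (ShuffleAlgebra m) := inferInstanceAs (Module ℝ (Word m → ℝ))

noncomputable instance : CommRing (ShuffleAlgebra m) where
  __ := (inferInstance : AddCommGroup (ShuffleAlgebra m))
  mul := shuffle
  one := unitSeries m
  mul_assoc := shuffle_assoc
  mul_comm := shuffle_comm
  mul_one := shuffle_unit
  one_mul a := (shuffle_comm _ a).trans (shuffle_unit a)
  left_distrib := shuffle_add
  right_distrib := add_shuffle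
  zero_mul a := (shuffle_comm _ a).trans (shuffle_zero a)
  mul_zero := shuffle_zero

noncomputable instance : Algebra ℝ (ShuffleAlgebra m) :=
  Algebra.ofModule smul_shuffle (fun r a b => shuffle_smul r a b)

/-- The coefficient of a word, as a linear functional. -/
def coeff (ξ : Word m) : ShuffleAlgebra m →ₗ[ℝ] ℝ := LinearMap.proj (R := ℝ) (φ := fun _ => ℝ) ξ

theorem ext {a b : ShuffleAlgebra m} (h : ∀ ξ, coeff ξ a = coeff ξ b) : a = b := funext h

theorem coeff_nil_mul (a b : ShuffleAlgebra m) : coeff [] (a * b) = coeff [] a * coeff [] b :=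
  shuffle_nil a b

theorem coeff_nil_one : coeff [] (1 : ShuffleAlgebra m) = 1 := by
  change unitSeries m [] = 1
  simp [unitSeries]

/-- The left derivative by a letter, as a derivation of the shuffle algebra. -/
noncomputable def D (x : Fin (m + 1)) : Derivation ℝ (ShuffleAlgebra m) (ShuffleAlgebra m) :=
  Derivation.mk'
    { toFun := shift x
      map_add' := fun _ _ => rfl
      map_smul' := fun _ _ => rfl }
    (shift_shuffle' x)

theorem coeff_cons (x : Fin (m + 1)) (ξ : Word m) (a : ShuffleAlgebra m) :
    coeff (x :: ξ) a = coeff ξ (D x a) := rfl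

theorem D_mul (x : Fin (m + 1)) (a b : ShuffleAlgebra m) : D x (a * b) = D x a * b + a * D x b := by
  rw [Derivation.leibniz, smul_eq_mul, smul_eq_mul]
  ring

/-- Two series agree on all words of length less than `n`. -/
def AgreeBelow (n : ℕ) (a b : ShuffleAlgebra m) : Prop :=
  ∀ ξ : Word m, ξ.length < n → coeff ξ a = coeff ξ b

theorem AgreeBelow.refl (n : ℕ) (a : ShuffleAlgebra m) : AgreeBelow n a a := fun _ _ => rfl

theorem AgreeBelow.symm {n : ℕ} {a b : ShuffleAlgebra m} (h : AgreeBelow n a b) :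
    AgreeBelow n b a := fun ξ hξ => (h ξ hξ).symm

theorem AgreeBelow.trans {n : ℕ} {a b c : ShuffleAlgebra m} (h : AgreeBelow n a b)
    (h' : AgreeBelow n b c) : AgreeBelow n a c := fun ξ hξ => (h ξ hξ).trans (h' ξ hξ)

theorem AgreeBelow.mono {n k : ℕ} (hk : k ≤ n) {a b : ShuffleAlgebra m} (h : AgreeBelow n a b) :
    AgreeBelow k a b := fun ξ hξ => h ξ (hξ.trans_le hk)

theorem agreeBelow_zero (a b : ShuffleAlgebra m) : AgreeBelow 0 a b :=
  fun _ h => absurd h (Nat.not_lt_zero _)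

/-- A nonempty word is a letter followed by a shorter word. This is the induction step behind most
identities below. -/
theorem agreeBelow_succ {n : ℕ} {a b : ShuffleAlgebra m} :
    AgreeBelow (n + 1) a b ↔ coeff [] a = coeff [] b ∧ ∀ x, AgreeBelow n (D x a) (D x b) := by
  constructor
  · exact fun h => ⟨h [] (by simp), fun x ξ hξ => h (x :: ξ) (by simpa using hξ)⟩
  · rintro ⟨h0, h1⟩ ξ hξ
    cases ξ with
    | nil => exact h0
    | cons x ξ => exact h1 x ξ (by simpa using hξ)

theorem eq_of_agreeBelow {a b : ShuffleAlgebra m} (h : ∀ n, AgreeBelow n a b) : a = b :=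
  ext fun ξ => h _ ξ ξ.length.lt_succ_self

theorem AgreeBelow.add {n : ℕ} {a b a' b' : ShuffleAlgebra m} (h : AgreeBelow n a a')
    (h' : AgreeBelow n b b') : AgreeBelow n (a + b) (a' + b') := fun ξ hξ => by
  rw [map_add, map_add, h ξ hξ, h' ξ hξ]

theorem AgreeBelow.neg {n : ℕ} {a a' : ShuffleAlgebra m} (h : AgreeBelow n a a') :
    AgreeBelow n (-a) (-a') := fun ξ hξ => by
  rw [map_neg, map_neg, h ξ hξ]

theorem AgreeBelow.mul {n : ℕ} {a b a' b' : ShuffleAlgebra m} (h : AgreeBelow n a a')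
    (h' : AgreeBelow n b b') : AgreeBelow n (a * b) (a' * b') := by
  induction n generalizing a b a' b' with
  | zero => exact agreeBelow_zero _ _
  | succ n ih =>
    have hn := h.mono n.le_succ
    have hn' := h'.mono n.le_succ
    rw [agreeBelow_succ] at h h' ⊢
    refine ⟨by rw [coeff_nil_mul, coeff_nil_mul, h.1, h'.1], fun x => ?_⟩
    rw [D_mul, D_mul]
    exact (ih (h.2 x) hn').add (ih hn (h'.2 x))

/-! ### Mixed composition as an algebra endomorphism -/

/-- The series by which a letter multiplies in the mixed composition: `1` for `x₀` and `d_i` for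
`x_i`. -/
noncomputable def letterFactor (d : Fin m → ShuffleAlgebra m) (x : Fin (m + 1)) :
    ShuffleAlgebra m :=
  Fin.cases 1 d x

@[simp]
theorem letterFactor_zero (d : Fin m → ShuffleAlgebra m) : letterFactor d 0 = 1 := rfl

@[simp]
theorem letterFactor_succ (d : Fin m → ShuffleAlgebra m) (i : Fin m) :
    letterFactor d i.succ = d i := rfl

/-- The mixed composition of a word, as an element of the shuffle algebra. -/
noncomputable def mixMonomial (d : Fin m → ShuffleAlgebra m) (η : Word m) : ShuffleAlgebra m :=
  mixWord d η

theorem coeff_cons_mixMonomial_cons (d : Fin m → ShuffleAlgebra m) (x y : Fin (m + 1))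
    (η ξ : Word m) : coeff (x :: ξ) (mixMonomial d (y :: η)) =
      if x = y then coeff ξ (letterFactor d y * mixMonomial d η) else 0 := by
  have h : Fin.cases (mixWord d η) (fun i => shuffle (d i) (mixWord d η)) y =
      letterFactor d y * mixMonomial d η := by
    refine Fin.cases ?_ (fun i => ?_) y
    · exact (one_mul (mixMonomial d η)).symm
    · rfl
  exact congrArg (fun a : ShuffleAlgebra m => if x = y then coeff ξ a else 0) h

theorem coeff_mixMonomial_eq_zero (d : Fin m → ShuffleAlgebra m) (η ξ : Word m)
    (h : ξ.length < η.length) : coeff ξ (mixMonomial d η) = 0 :=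
  mixWord_eq_zero d η ξ h

/-- The mixed composition product with `δ_d`, on scalar series. -/
noncomputable def mixFun (d : Fin m → ShuffleAlgebra m) (a : ShuffleAlgebra m) :
    ShuffleAlgebra m :=
  fun ξ => ∑ᶠ η : Word m, coeff η a * coeff ξ (mixMonomial d η)

theorem coeff_mixFun (d : Fin m → ShuffleAlgebra m) (a : ShuffleAlgebra m) (ξ : Word m) :
    coeff ξ (mixFun d a) = ∑ᶠ η : Word m, coeff η a * coeff ξ (mixMonomial d η) := rfl

/-- Mixed monomials of long words start at high order, so the locally finite sum can be replaced by
a finite one, through which products and linear maps pass. -/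
theorem agreeBelow_mixFun_sum (d : Fin m → ShuffleAlgebra m) (a : ShuffleAlgebra m) (n : ℕ) :
    AgreeBelow n (mixFun d a) (∑ η ∈ (List.finite_length_lt (Fin (m + 1)) n).toFinset,
      coeff η a • mixMonomial d η) := by
  intro ξ hξ
  rw [map_sum, coeff_mixFun, finsum_eq_sum_of_support_subset]
  · exact Finset.sum_congr rfl fun η _ => by rw [map_smul, smul_eq_mul]
  · intro η hη
    by_contra hlt
    refine hη ?_
    dsimp only
    rw [coeff_mixMonomial_eq_zero d η ξ, mul_zero]
    simp at hlt
    omega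

theorem coeff_nil_mixFun (d : Fin m → ShuffleAlgebra m) (a : ShuffleAlgebra m) :
    coeff [] (mixFun d a) = coeff [] a := by
  rw [coeff_mixFun, finsum_eq_single _ []]
  · have h : coeff [] (mixMonomial d []) = 1 := coeff_nil_one
    rw [h, mul_one]
  · intro η hη
    rw [coeff_mixMonomial_eq_zero d η [] (List.length_pos_iff.mpr hη), mul_zero]

/-- Only words beginning with `x` contribute to coefficients of words beginning with `x`. Together
with the constant term, this rule determines mixed composition; later arguments rely on it instead
of the defining sum. -/
theorem D_mixFun (d : Fin m → ShuffleAlgebra m) (a : ShuffleAlgebra m) (x : Fin (m + 1)) :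
    D x (mixFun d a) = letterFactor d x * mixFun d (D x a) := by
  refine ext fun ξ => ?_
  have hinj : Function.Injective (x :: · : Word m → Word m) := List.cons_injective
  have hrange : (Function.support fun η : Word m => coeff η a * coeff (x :: ξ) (mixMonomial d η)) ⊆
      Set.range (x :: ·) := by
    intro η hη
    cases η with
    | nil =>
      have h : coeff (x :: ξ) (mixMonomial d []) = 0 := congrFun (shift_unitSeries x) ξ
      simp [h] at hη
    | cons y η =>
      by_cases hy : x = y
      · exact ⟨η, by simp [hy]⟩
      · simp [coeff_cons_mixMonomial_cons, hy] at hη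
  rw [← coeff_cons, coeff_mixFun, finsum_eq_finsum_of_injective hinj hrange,
    ((AgreeBelow.refl (ξ.length + 1) _).mul (agreeBelow_mixFun_sum d (D x a) (ξ.length + 1))) ξ
      ξ.length.lt_succ_self, Finset.mul_sum, map_sum, finsum_eq_sum_of_support_subset]
  · refine Finset.sum_congr rfl fun η _ => ?_
    rw [coeff_cons_mixMonomial_cons, if_pos rfl, mul_smul_comm, map_smul, smul_eq_mul, coeff_cons]
  · intro η hη
    by_contra hlt
    refine hη ?_
    dsimp only
    rw [coeff_mixMonomial_eq_zero d (x :: η) (x :: ξ), mul_zero]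
    simp at hlt ⊢
    omega

theorem mixFun_add (d : Fin m → ShuffleAlgebra m) (a b : ShuffleAlgebra m) :
    mixFun d (a + b) = mixFun d a + mixFun d b := by
  refine eq_of_agreeBelow fun n => ?_
  induction n generalizing a b with
  | zero => exact agreeBelow_zero _ _
  | succ n ih =>
    refine agreeBelow_succ.mpr ⟨by simp [coeff_nil_mixFun], fun x => ?_⟩
    simp only [map_add, D_mixFun, ← mul_add]
    exact (AgreeBelow.refl _ _).mul (ih _ _)

theorem mixFun_zero (d : Fin m → ShuffleAlgebra m) : mixFun d 0 = 0 := by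
  simpa using mixFun_add d 0 0

theorem mixFun_mul (d : Fin m → ShuffleAlgebra m) (a b : ShuffleAlgebra m) :
    mixFun d (a * b) = mixFun d a * mixFun d b := by
  refine eq_of_agreeBelow fun n => ?_
  induction n generalizing a b with
  | zero => exact agreeBelow_zero _ _
  | succ n ih =>
    refine agreeBelow_succ.mpr ⟨by simp [coeff_nil_mixFun, coeff_nil_mul], fun x => ?_⟩
    have h := (AgreeBelow.refl n (letterFactor d x)).mul ((ih (D x a) b).add (ih a (D x b)))
    simp only [D_mul, D_mixFun, mixFun_add]
    convert h using 1
    ring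

theorem mixFun_algebraMap (d : Fin m → ShuffleAlgebra m) (r : ℝ) :
    mixFun d (algebraMap ℝ _ r) = algebraMap ℝ _ r := by
  -- No induction is needed: all left derivatives of both sides vanish.
  refine eq_of_agreeBelow fun n => AgreeBelow.mono n.le_succ ?_
  refine agreeBelow_succ.mpr ⟨coeff_nil_mixFun _ _, fun x => ?_⟩
  rw [D_mixFun, Derivation.map_algebraMap, mixFun_zero, mul_zero]
  exact AgreeBelow.refl _ _

/-- The mixed composition product with `δ_d` is an endomorphism of the shuffle algebra. -/
noncomputable def mix (d : Fin m → ShuffleAlgebra m) : ShuffleAlgebra m →ₐ[ℝ] ShuffleAlgebra m where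
  toFun := mixFun d
  map_one' := by simpa using mixFun_algebraMap d 1
  map_mul' := mixFun_mul d
  map_zero' := mixFun_zero d
  map_add' := mixFun_add d
  commutes' := mixFun_algebraMap d

theorem coeff_nil_mix (d : Fin m → ShuffleAlgebra m) (a : ShuffleAlgebra m) :
    coeff [] (mix d a) = coeff [] a := coeff_nil_mixFun d a

theorem D_mix (d : Fin m → ShuffleAlgebra m) (a : ShuffleAlgebra m) (x : Fin (m + 1)) :
    D x (mix d a) = letterFactor d x * mix d (D x a) := D_mixFun d a x

theorem AgreeBelow.mix {n : ℕ} {a b : ShuffleAlgebra m} (d : Fin m → ShuffleAlgebra m)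
    (h : AgreeBelow n a b) : AgreeBelow n (mix d a) (mix d b) := by
  induction n generalizing a b with
  | zero => exact agreeBelow_zero _ _
  | succ n ih =>
    rw [agreeBelow_succ] at h ⊢
    refine ⟨by rw [coeff_nil_mix, coeff_nil_mix, h.1], fun x => ?_⟩
    rw [D_mix, D_mix]
    exact (AgreeBelow.refl _ _).mul (ih (h.2 x))

theorem AgreeBelow.letterFactor {n : ℕ} {d e : Fin m → ShuffleAlgebra m}
    (h : ∀ i, AgreeBelow n (d i) (e i)) (x : Fin (m + 1)) :
    AgreeBelow n (letterFactor d x) (letterFactor e x) :=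
  Fin.cases (AgreeBelow.refl _ _) h x

/-- `d` enters only through the factor in front of a derivative, so dependence on `d` loses no
order; this feeds the contraction estimate for inverses. -/
theorem AgreeBelow.mix_left {n : ℕ} {d e : Fin m → ShuffleAlgebra m}
    (h : ∀ i, AgreeBelow n (d i) (e i)) (a : ShuffleAlgebra m) :
    AgreeBelow n (ShuffleAlgebra.mix d a) (ShuffleAlgebra.mix e a) := by
  induction n generalizing a with
  | zero => exact agreeBelow_zero _ _
  | succ n ih =>
    have h' := fun i => (h i).mono n.le_succ
    refine agreeBelow_succ.mpr ⟨by rw [coeff_nil_mix, coeff_nil_mix], fun x => ?_⟩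
    rw [D_mix, D_mix]
    exact (AgreeBelow.letterFactor h' x).mul (ih h' _)

theorem mix_one (a : ShuffleAlgebra m) : mix 1 a = a := by
  refine eq_of_agreeBelow fun n => ?_
  induction n generalizing a with
  | zero => exact agreeBelow_zero _ _
  | succ n ih =>
    refine agreeBelow_succ.mpr ⟨coeff_nil_mix _ _, fun x => ?_⟩
    have h : letterFactor (1 : Fin m → ShuffleAlgebra m) x = 1 := by
      refine Fin.cases rfl (fun i => rfl) x
    rw [D_mix, h, one_mul]
    exact ih _

/-! ### The composition monoid and its inverses -/

/-- The multiplicative composition product `δ_d ∘ δ_e` in the shuffle algebra. -/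
noncomputable def comp (d e : Fin m → ShuffleAlgebra m) : Fin m → ShuffleAlgebra m :=
  fun i => e i * mix e (d i)

theorem mix_mix (d e : Fin m → ShuffleAlgebra m) (a : ShuffleAlgebra m) :
    mix e (mix d a) = mix (comp d e) a := by
  refine eq_of_agreeBelow fun n => ?_
  induction n generalizing a with
  | zero => exact agreeBelow_zero _ _
  | succ n ih =>
    refine agreeBelow_succ.mpr ⟨by simp only [coeff_nil_mix], fun x => ?_⟩
    have h : letterFactor e x * mix e (letterFactor d x) = letterFactor (comp d e) x := by
      refine Fin.cases ?_ (fun i => ?_) x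
      · simp
      · simp [comp]
    rw [D_mix, D_mix, D_mix, map_mul, ← mul_assoc, h]
    exact (AgreeBelow.refl _ _).mul (ih _)

theorem comp_assoc (a b c : Fin m → ShuffleAlgebra m) : comp (comp a b) c = comp a (comp b c) := by
  funext i
  simp only [comp, map_mul, mix_mix, mul_assoc]

theorem comp_one (d : Fin m → ShuffleAlgebra m) : comp d 1 = d := by
  funext i
  simp [comp, mix_one]

theorem one_comp (d : Fin m → ShuffleAlgebra m) : comp 1 d = d := by
  funext i
  simp [comp]

/-- A self-map of tuples of series that gains one order of agreement has a fixed point. -/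
theorem exists_fixedPoint {ι : Type*} (T : (ι → ShuffleAlgebra m) → ι → ShuffleAlgebra m)
    (hT : ∀ n d e, (∀ i, AgreeBelow n (d i) (e i)) → ∀ i, AgreeBelow (n + 1) (T d i) (T e i)) :
    ∃ e, T e = e := by
  let s : ℕ → ι → ShuffleAlgebra m := fun n => T^[n] 0
  have hs : ∀ n, s (n + 1) = T (s n) := fun n => Function.iterate_succ_apply' T n 0
  have h1 : ∀ n i, AgreeBelow n (s n i) (s (n + 1) i) := by
    intro n
    induction n with
    | zero => exact fun i => agreeBelow_zero _ _
    | succ n ih =>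
      rw [hs (n + 1)]
      nth_rewrite 1 [hs n]
      exact hT n _ _ ih
  have h2 : ∀ n k i, AgreeBelow n (s n i) (s (n + k) i) := by
    intro n k i
    induction k with
    | zero => exact AgreeBelow.refl _ _
    | succ k ih => exact ih.trans ((h1 (n + k) i).mono (n.le_add_right k))
  -- The coefficient at `ξ` is constant from iterate `ξ.length + 1` onwards, so this is the limit of
  -- the iterates.
  let e : ι → ShuffleAlgebra m := fun i ξ => coeff ξ (s (ξ.length + 1) i)
  have he : ∀ n i, AgreeBelow n (e i) (s n i) := by
    intro n i ξ hξ
    obtain ⟨k, rfl⟩ := Nat.exists_eq_add_of_le (Nat.succ_le_of_lt hξ)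
    exact h2 (ξ.length + 1) k i ξ ξ.length.lt_succ_self
  refine ⟨e, funext fun i => eq_of_agreeBelow fun n => ?_⟩
  have h := (hT n _ _ (he n) i).trans (hs n ▸ (he (n + 1) i).symm)
  exact h.mono n.le_succ

/-- The series with prescribed constant term and left derivatives. -/
noncomputable def ofDeriv (r : ℝ) (f : Fin (m + 1) → ShuffleAlgebra m) : ShuffleAlgebra m
  | [] => r
  | x :: ξ => coeff ξ (f x)

theorem D_ofDeriv (r : ℝ) (f : Fin (m + 1) → ShuffleAlgebra m) (x : Fin (m + 1)) :
    D x (ofDeriv r f) = f x := rfl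

/-- Differentiating `e i * mix e (d i) = 1` and multiplying by `e i` expresses `D x (e i)` through
`e` and `D x (d i)`. Integrating the right-hand side gains one order, so a solution exists as a
fixed point. -/
theorem exists_comp_eq_one (d : Fin m → ShuffleAlgebra m) (hd : ∀ i, coeff [] (d i) ≠ 0) :
    ∃ e, comp d e = 1 := by
  obtain ⟨e, he⟩ := exists_fixedPoint (fun e i => ofDeriv (coeff [] (d i))⁻¹
    fun x => -(e i * e i * (letterFactor e x * mix e (D x (d i)))) ) (by
      intro n a b h i
      refine agreeBelow_succ.mpr ⟨rfl, fun x => ?_⟩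
      rw [D_ofDeriv, D_ofDeriv]
      exact (((h i).mul (h i)).mul
        ((AgreeBelow.letterFactor h x).mul (AgreeBelow.mix_left h _))).neg)
  have h0 : ∀ i, coeff [] (e i) = (coeff [] (d i))⁻¹ := fun i => by
    conv_lhs => rw [← he]
    rfl
  have hD : ∀ i x, D x (e i) = -(e i * e i * (letterFactor e x * mix e (D x (d i)))) := fun i x => by
    conv_lhs => rw [← he]
    rfl
  refine ⟨e, funext fun i => eq_of_agreeBelow fun n => ?_⟩
  induction n with
  | zero => exact agreeBelow_zero _ _
  | succ n ih =>
    refine agreeBelow_succ.mpr ⟨?_, fun x => ?_⟩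
    · rw [comp, coeff_nil_mul, coeff_nil_mix, h0, inv_mul_cancel₀ (hd i)]
      exact coeff_nil_one.symm
    -- With `u = comp d e i`, the equation for `e` gives `D x u` as a multiple of `1 - u`; agreement
    -- of `u` with `1` thus propagates to the next order.
    · have h : D x (comp d e i) =
          e i * (letterFactor e x * mix e (D x (d i))) * (1 + -(comp d e i)) := by
        rw [comp, D_mul, D_mix, hD]
        ring
      have h' := (AgreeBelow.refl n (e i * (letterFactor e x * mix e (D x (d i))))).mul
        ((AgreeBelow.refl n 1).add ih.neg)
      rw [h]
      refine h'.trans ?_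
      rw [Pi.one_apply, add_neg_cancel, mul_zero, Derivation.map_one_eq_zero]
      exact AgreeBelow.refl _ _

theorem coeff_nil_ne_zero_of_comp_eq_one {d e : Fin m → ShuffleAlgebra m} (h : comp d e = 1)
    (i : Fin m) : coeff [] (e i) ≠ 0 := by
  have h' := congrArg (coeff []) (congrFun h i)
  rw [comp, coeff_nil_mul, Pi.one_apply, coeff_nil_one] at h'
  exact left_ne_zero_of_mul_eq_one h'

/-- Right inverses for the multiplicative composition product are two-sided. -/
theorem comp_eq_one_comm {d e : Fin m → ShuffleAlgebra m} (h : comp d e = 1) : comp e d = 1 := by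
  obtain ⟨f, hf⟩ := exists_comp_eq_one e (coeff_nil_ne_zero_of_comp_eq_one h)
  -- The usual monoid argument: `d = d ∘ (e ∘ f) = (d ∘ e) ∘ f = f`.
  have hdf : d = f := by
    rw [← comp_one d, ← hf, ← comp_assoc, h, one_comp]
  rw [hdf, hf]

theorem eq_of_comp_eq_one {d e f : Fin m → ShuffleAlgebra m} (he : comp d e = 1)
    (hf : comp d f = 1) : e = f := by
  rw [← one_comp f, ← comp_eq_one_comm he, comp_assoc, hf, comp_one]

end ShuffleAlgebra

/-! ### Wiener–Fliess composition as substitution -/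

variable {q : ℕ}

theorem length_monomialWord (n : Fin q →₀ ℕ) : (monomialWord n).length = n.degree := by
  rw [monomialWord, List.length_flatMap, Finsupp.degree_eq_sum]
  simp only [List.length_replicate]
  rw [← List.ofFn_eq_map, List.sum_ofFn]

namespace ShuffleAlgebra

theorem shufflePow_monomialWord (c : Fin q → ShuffleAlgebra m) (n : Fin q →₀ ℕ) :
    shufflePow c (monomialWord n) = ∏ i, c i ^ n i := by
  have h : ∀ w : List (Fin q), shufflePow c w = (w.map c).prod := by
    intro w
    induction w with
    | nil => rfl
    | cons i w ih =>
      rw [List.map_cons, List.prod_cons, ← ih]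
      rfl
  rw [h, monomialWord, List.map_flatMap, List.flatMap_def, List.prod_flatten, List.map_map]
  simp only [Function.comp_def, List.map_replicate, List.prod_replicate]
  rw [← List.ofFn_eq_map, List.prod_ofFn]

theorem coeff_prod_pow_eq_zero (c : Fin q → ShuffleAlgebra m) (hc : ∀ i, coeff [] (c i) = 0)
    (n : Fin q →₀ ℕ) (ξ : Word m) (h : ξ.length < n.degree) : coeff ξ (∏ i, c i ^ n i) = 0 := by
  rw [← shufflePow_monomialWord]
  exact shufflePow_eq_zero c hc _ ξ (by rwa [length_monomialWord])

theorem agreeBelow_aeval_zero (c : Fin q → ShuffleAlgebra m) (hc : ∀ i, coeff [] (c i) = 0)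
    (N : ℕ) (p : MvPolynomial (Fin q) ℝ) (hp : ∀ n, n.degree < N → p.coeff n = 0) :
    AgreeBelow N (MvPolynomial.aeval c p) 0 := by
  intro ξ hξ
  rw [MvPolynomial.aeval_def, MvPolynomial.eval₂_eq', map_sum, map_zero]
  refine Finset.sum_eq_zero fun n _ => ?_
  rw [← Algebra.smul_def, map_smul, smul_eq_mul]
  by_cases hn : n.degree < N
  · rw [hp n hn, zero_mul]
  · rw [coeff_prod_pow_eq_zero c hc n ξ (by omega), mul_zero]

/-- The Wiener–Fliess composition of a scalar commutative series with a tuple of series. -/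
noncomputable def subst (c : Fin q → ShuffleAlgebra m) (d : MvPowerSeries (Fin q) ℝ) :
    ShuffleAlgebra m :=
  fun ξ => ∑ᶠ n : Fin q →₀ ℕ, MvPowerSeries.coeff n d * shufflePow c (monomialWord n) ξ

theorem coeff_subst (c : Fin q → ShuffleAlgebra m) (d : MvPowerSeries (Fin q) ℝ) (ξ : Word m) :
    coeff ξ (subst c d) =
      ∑ᶠ n : Fin q →₀ ℕ, MvPowerSeries.coeff n d * coeff ξ (∏ i, c i ^ n i) :=
  finsum_congr fun n => congrArg (fun a : ShuffleAlgebra m => MvPowerSeries.coeff n d * coeff ξ a)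
    (shufflePow_monomialWord c n)

/-- Properness pushes a monomial of degree `n` to order at least `n`, so up to order `N`
substitution is polynomial evaluation of a truncation. -/
theorem agreeBelow_subst_aeval (c : Fin q → ShuffleAlgebra m) (hc : ∀ i, coeff [] (c i) = 0)
    (N : ℕ) (d : MvPowerSeries (Fin q) ℝ) :
    AgreeBelow N (subst c d) (MvPolynomial.aeval c (d.truncTotal N)) := by
  intro ξ hξ
  rw [coeff_subst, MvPolynomial.aeval_def, MvPolynomial.eval₂_eq', map_sum,
    finsum_eq_sum_of_support_subset]
  · refine Finset.sum_congr rfl fun n hn => ?_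
    rw [← Algebra.smul_def, map_smul, smul_eq_mul]
    have hdeg : n.degree < N := by
      by_contra hlt
      exact MvPolynomial.mem_support_iff.mp hn
        (MvPowerSeries.coeff_truncTotal_eq_zero d (not_lt.mp hlt))
    rw [MvPowerSeries.coeff_truncTotal d hdeg]
  · intro n hn
    have hdeg : n.degree < N := by
      by_contra hlt
      exact hn (by simp [coeff_prod_pow_eq_zero c hc n ξ (by omega)])
    rw [Finset.mem_coe, MvPolynomial.mem_support_iff, MvPowerSeries.coeff_truncTotal d hdeg]
    exact left_ne_zero_of_mul hn

theorem subst_one (c : Fin q → ShuffleAlgebra m) (hc : ∀ i, coeff [] (c i) = 0) :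
    subst c 1 = 1 := by
  -- The shift to `n + 1` is needed because truncating `1` at total degree `0` gives `0`.
  refine eq_of_agreeBelow fun n => AgreeBelow.mono n.le_succ ?_
  simpa only [MvPowerSeries.truncTotal_one n.succ_ne_zero, map_one] using
    agreeBelow_subst_aeval c hc (n + 1) 1

theorem subst_mul (c : Fin q → ShuffleAlgebra m) (hc : ∀ i, coeff [] (c i) = 0)
    (d d' : MvPowerSeries (Fin q) ℝ) : subst c (d * d') = subst c d * subst c d' := by
  refine eq_of_agreeBelow fun N => ?_
  have h := agreeBelow_aeval_zero c hc N
    ((d * d').truncTotal N - d.truncTotal N * d'.truncTotal N) (fun n hn => by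
      rw [MvPolynomial.coeff_sub, MvPowerSeries.coeff_truncTotal _ hn,
        MvPowerSeries.coeff_truncTotal_mul_truncTotal_eq_coeff_mul _ _ hn, sub_self])
  have h' := h.add (AgreeBelow.refl N
    (MvPolynomial.aeval c (d.truncTotal N) * MvPolynomial.aeval c (d'.truncTotal N)))
  rw [map_sub, map_mul (MvPolynomial.aeval c) (d.truncTotal N), sub_add_cancel, zero_add] at h'
  exact ((agreeBelow_subst_aeval c hc N _).trans h').trans
    ((agreeBelow_subst_aeval c hc N d).mul (agreeBelow_subst_aeval c hc N d')).symm

theorem coeff_nil_subst (c : Fin q → ShuffleAlgebra m) (hc : ∀ i, coeff [] (c i) = 0)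
    (d : MvPowerSeries (Fin q) ℝ) : coeff [] (subst c d) = MvPowerSeries.constantCoeff d := by
  rw [coeff_subst, finsum_eq_single _ 0]
  · simp [coeff_nil_one]
  · intro n hn
    have h : 0 < n.degree := Nat.pos_of_ne_zero fun h => hn ((Finsupp.degree_eq_zero_iff n).mp h)
    rw [coeff_prod_pow_eq_zero c hc n [] h, mul_zero]

/-- An algebra homomorphism commutes with polynomial evaluation, and `mix e` preserves order of
agreement, so the identity passes to power series. -/
theorem mix_subst (e : Fin m → ShuffleAlgebra m) (c : Fin q → ShuffleAlgebra m)
    (hc : ∀ i, coeff [] (c i) = 0) (d : MvPowerSeries (Fin q) ℝ) :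
    mix e (subst c d) = subst (fun i => mix e (c i)) d := by
  refine eq_of_agreeBelow fun N => ?_
  have h := (agreeBelow_subst_aeval c hc N d).mix e
  rw [← AlgHom.comp_apply, MvPolynomial.comp_aeval] at h
  exact h.trans (agreeBelow_subst_aeval _ (fun i => (coeff_nil_mix e _).trans (hc i)) N d).symm

end ShuffleAlgebra

/-! ### The feedback equation and the action law -/

open ShuffleAlgebra

theorem isCompInverse_iff (d e : VecSeries m m) : IsCompInverse d e ↔ comp (m := m) d e = 1 :=
  ⟨fun h => h.1, fun h => ⟨h, comp_eq_one_comm h⟩⟩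

theorem wienerFliess_eq_subst {k : ℕ} (d : Fin k → MvPowerSeries (Fin q) ℝ) (c : VecSeries m q) :
    wienerFliess d c = fun i => subst (m := m) c (d i) := rfl

/-- The series `d ∘̂ c` with `d` purely improper and `c` proper is invertible for the
multiplicative composition product. -/
theorem existsUnique_isCompInverse_wienerFliess (c : ProperSeries m q) (d : PurelyImproper m q) :
    ∃! e : VecSeries m m, IsCompInverse (wienerFliess d.1 c.1) e := by
  simp only [isCompInverse_iff]
  obtain ⟨e, he⟩ := exists_comp_eq_one (m := m) (wienerFliess d.1 c.1) (fun i => by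
    rw [wienerFliess_eq_subst, coeff_nil_subst c.1 c.2]
    exact d.2 i)
  exact ⟨e, he, fun f hf => eq_of_comp_eq_one hf he⟩

theorem isCompInverse_compInv {d : VecSeries m m} (h : ∃ e, IsCompInverse d e) :
    IsCompInverse d (compInv d) := by
  rw [compInv, dif_pos h]
  exact h.choose_spec

theorem isProper_mixComp {c : VecSeries m q} (hc : IsProper c) (d : VecSeries m m) :
    IsProper (mixComp c d) := fun i => (coeff_nil_mix (m := m) d (c i)).trans (hc i)

theorem PurelyImproper.subst_mul_subst_inv (d : PurelyImproper m q) (c : Fin q → ShuffleAlgebra m)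
    (hc : ∀ i, coeff [] (c i) = 0) (i : Fin m) : subst c (d.1 i) * subst c ((d⁻¹).1 i) = 1 := by
  rw [← subst_mul c hc, ← subst_one c hc]
  exact congrArg (fun a : PurelyImproper m q => subst c (a.1 i)) (mul_inv_cancel d)

/-- The feedback series is the solution `e` of the fixed point equation `e = d ∘̂ (c ↶ δ_e)`. -/
theorem eq_compInv_iff (c : ProperSeries m q) (d : PurelyImproper m q) (e : VecSeries m m) :
    e = compInv (wienerFliess (d⁻¹).1 c.1) ↔ e = wienerFliess d.1 (mixComp c.1 e) := by
  have hinv := isCompInverse_compInv (existsUnique_isCompInverse_wienerFliess c d⁻¹).exists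
  have h1 : e = compInv (wienerFliess (d⁻¹).1 c.1) ↔
      comp (m := m) (wienerFliess (d⁻¹).1 c.1) e = 1 :=
    ⟨fun h => h ▸ hinv.1, fun h => eq_of_comp_eq_one h hinv.1⟩
  rw [h1]
  let c' : Fin q → ShuffleAlgebra m := fun i => mix (m := m) e (c.1 i)
  have hc' : ∀ i, coeff [] (c' i) = 0 := isProper_mixComp c.2 e
  let e' : Fin m → ShuffleAlgebra m := e
  have h2 : ∀ i, comp (m := m) (wienerFliess (d⁻¹).1 c.1) e i = e' i * subst c' ((d⁻¹).1 i) :=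
    fun i => congrArg (e' i * ·) (mix_subst e' c.1 c.2 _)
  have hd := d.subst_mul_subst_inv c' hc'
  constructor
  · intro h
    have h' : e' = fun i => subst c' (d.1 i) := by
      funext i
      have hi : e' i * subst c' ((d⁻¹).1 i) = 1 := (h2 i).symm.trans (congrFun h i)
      -- Uniqueness of inverses: both `e' i` and `subst c' (d.1 i)` invert `subst c' ((d⁻¹).1 i)`.
      linear_combination (-e' i) * hd i + subst c' (d.1 i) * hi
    exact h'
  · intro h
    have h' : e' = fun i => subst c' (d.1 i) := h
    funext i
    rw [h2, h']
    exact hd i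

theorem staticFeedback_eq (c : ProperSeries m q) (d : PurelyImproper m q) {e : VecSeries m m}
    (h : e = wienerFliess d.1 (mixComp c.1 e)) : staticFeedback c.1 d = mixComp c.1 e := by
  rw [staticFeedback, ← (eq_compInv_iff c d e).mpr h]

theorem isProper_staticFeedback (c : ProperSeries m q) (d : PurelyImproper m q) :
    IsProper (staticFeedback c.1 d) := isProper_mixComp c.2 _

theorem staticFeedback_one (c : ProperSeries m q) :
    staticFeedback c.1 (1 : PurelyImproper m q) = c.1 := by
  have h1 : mixComp c.1 (unitVec m m) = c.1 := funext fun i => mix_one (m := m) (c.1 i)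
  rw [staticFeedback_eq c 1 (e := unitVec m m), h1]
  rw [h1]
  exact (funext fun i => subst_one (m := m) c.1 c.2).symm

theorem staticFeedback_staticFeedback (c : ProperSeries m q) (d₁ d₂ : PurelyImproper m q) :
    staticFeedback (staticFeedback c.1 d₁) d₂ = staticFeedback c.1 (d₁ * d₂) := by
  let c₁ : ProperSeries m q := ⟨staticFeedback c.1 d₁, isProper_staticFeedback c d₁⟩
  let e₁ : Fin m → ShuffleAlgebra m := compInv (wienerFliess (d₁⁻¹).1 c.1)
  let e₂ : Fin m → ShuffleAlgebra m := compInv (wienerFliess (d₂⁻¹).1 c₁.1)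
  let c₂ : Fin q → ShuffleAlgebra m := fun i => mix e₂ (c₁.1 i)
  have hc₂ : ∀ i, coeff [] (c₂ i) = 0 := isProper_mixComp c₁.2 e₂
  have h₁ : e₁ = fun i => subst c₁.1 (d₁.1 i) := (eq_compInv_iff c d₁ e₁).mp rfl
  have h₂ : e₂ = fun i => subst c₂ (d₂.1 i) := (eq_compInv_iff c₁ d₂ e₂).mp rfl
  have hmix : ∀ i, c₂ i = mix (comp e₁ e₂) (c.1 i) := fun i => mix_mix e₁ e₂ _
  have he : comp e₁ e₂ = fun i => subst c₂ ((d₁ * d₂).1 i) := by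
    funext i
    have hi : mix e₂ (e₁ i) = subst c₂ (d₁.1 i) :=
      (congrArg (mix e₂) (congrFun h₁ i)).trans (mix_subst e₂ c₁.1 c₁.2 _)
    rw [comp, hi, congrFun h₂ i, mul_comm]
    exact (subst_mul c₂ hc₂ _ _).symm
  have h : staticFeedback c.1 (d₁ * d₂) = mixComp c.1 (comp e₁ e₂) := by
    refine staticFeedback_eq c (d₁ * d₂) (he.trans ?_)
    rw [funext hmix]
    rfl
  exact (funext hmix).trans h.symm

/-- The multiplicative static feedback product is a right action. -/
noncomputable abbrev feedbackAction (m q : ℕ) :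
    MulAction (PurelyImproper m q)ᵐᵒᵖ (ProperSeries m q) where
  smul d c := ⟨staticFeedback c.1 d.unop, isProper_staticFeedback c d.unop⟩
  one_smul c := Subtype.ext (staticFeedback_one c)
  -- Unopping reverses the product, so `b`, which acts first, supplies the inner loop.
  mul_smul a b c := Subtype.ext (staticFeedback_staticFeedback c b.unop a.unop).symm

end ChenFliess

theorem mainTheorem7 (m q : ℕ) :
    (∀ (c : ChenFliess.ProperSeries m q) (d : ChenFliess.PurelyImproper m q),
      ∃! e : ChenFliess.VecSeries m m,
        ChenFliess.IsCompInverse (ChenFliess.wienerFliess (d⁻¹).1 c.1) e) ∧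
    ∃ act : MulAction (ChenFliess.PurelyImproper m q)ᵐᵒᵖ (ChenFliess.ProperSeries m q),
      ∀ (c : ChenFliess.ProperSeries m q) (d : ChenFliess.PurelyImproper m q),
        (act.toSMul.smul (MulOpposite.op d) c).1 = ChenFliess.staticFeedback c.1 d :=
  ⟨fun c d => ChenFliess.existsUnique_isCompInverse_wienerFliess c d⁻¹,
    ChenFliess.feedbackAction m q, fun _ _ => rfl⟩
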